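/- For an $n\times n$ matrix $A$ over $\mathbb F_2$ and $b\in\mathbb F_2^n$, the system $Ax=b$ is encoded as a CNF formula by replacing each of its equations $\bigoplus_{k\in S}x_k=a$ with the conjunction of all clauses that contain each variable $x_k$, $k\in S$, exactly once (possibly negated) and no other variable, and that are implied by the equation. For a set $I$ of rows of $A$, the boundary $\partial I$ is the set of columns that contain a one in exactly one row of $I$. The matrix $A$ is an $(r,s,c)$-boundary expander if every row has at most $s$ ones and $|\partial I|\ge c\,|I|$ for every set $I$ of at most $r$ rows. Fix $\beta>1$ and let all logarithms be to base $\beta$. For every constant $K$ there is a constant $C$ (depending only on $K$ and $\beta$) such that the following holds for every $n$. Let $A$ be an $n\times n$ matrix over $\mathbb F_2$ of full rank, with exactly three ones in each row and at most $K\log n$ ones in each column, which is an $(r,3,\tfrac{11}{13})$-boundary expander with $r=n/\log^{14}n$. For $b\in\mathbb F_2^n$ let $\Phi_{i,j;b}$ be the CNF formula encoding the system $Ax=b$ together with the additional equation $x_i\oplus x_j=0$. Call a pair of indices $(i,j)$ with $i<j$ bad if for some $b$ one can substitute a value in $\{0,1\}$ for a single variable of $\Phi_{i,j;b}$ so that the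 resulting formula is unsatisfiable and has a tree-like resolution refutation of size (number of clauses in the refutation tree) less than $2^{\frac{9r}{130}-3}$. Then the number of bad pairs is at most $C\,n\log^2 n$. -/

import Mathlib

namespace XorSys

/-! ### Clauses, CNF formulas, substitution -/

/-- A literal over the variables `V`: the pair `(v, a)` is the literal that is true exactly when
`x_v = a`. Thus `(v, 1)` is `x_v` and `(v, 0)` is the negation of `x_v`. -/
abbrev Literal (V : Type) : Type := V × ZMod 2

/-- A clause: a finite set of literals, read as their disjunction. -/
abbrev Clause (V : Type) : Type := Finset (Literal V)

/-- A CNF formula: a finite set of clauses, read as their conjunction. -/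
abbrev CNF (V : Type) : Type := Finset (Clause V)

/-- The assignment `x` satisfies some literal of the clause. -/
def Clause.SatisfiedBy {V : Type} (C : Clause V) (x : V → ZMod 2) : Prop :=
  ∃ l ∈ C, x l.1 = l.2

/-- Some assignment satisfies all the clauses. -/
def CNF.Satisfiable {V : Type} (F : CNF V) : Prop :=
  ∃ x : V → ZMod 2, ∀ C ∈ F, Clause.SatisfiedBy C x

/-- The formula obtained by substituting `a` for the variable `v`: clauses with a literal that
became true are dropped, and the literal that became false is removed from the other clauses. -/
def CNF.subst {V : Type} [DecidableEq V] (F : CNF V) (v : V) (a : ZMod 2) : CNF V :=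
  (F.filter (fun C => (v, a) ∉ C)).image (fun C => C.erase (v, a + 1))

/-! ### Tree-like resolution -/

/-- Tree-like resolution derivations of a clause from the formula `F`: the leaves are clauses of
`F`, and an inner node is the resolvent of its two children on some variable `v`. -/
inductive ResTree {V : Type} [DecidableEq V] (F : CNF V) : Clause V → Type
  | leaf (C : Clause V) (hC : C ∈ F) : ResTree F C
  | resolve (v : V) (C D : Clause V) (hC : (v, 1) ∈ C) (hD : (v, 0) ∈ D)
      (s : ResTree F C) (t : ResTree F D) :
      ResTree F (C.erase (v, 1) ∪ D.erase (v, 0))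

/-- The size of a derivation: the number of clauses (nodes) in the tree. -/
def ResTree.size {V : Type} [DecidableEq V] {F : CNF V} : {C : Clause V} → ResTree F C → ℕ
  | _, .leaf _ _ => 1
  | _, .resolve _ _ _ _ _ s t => s.size + t.size + 1

/-- A tree-like resolution refutation: a derivation of the empty clause. -/
abbrev Refutation {V : Type} [DecidableEq V] (F : CNF V) : Type := ResTree F ∅

/-! ### Linear systems over the two-element field as CNF formulas -/

/-- The columns in which row `i` contains a one. -/
def rowSupport {R V : Type} [Fintype V] (M : Matrix R V (ZMod 2)) (i : R) : Finset V :=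
  Finset.univ.filter (fun j => M i j = 1)

/-- The canonical CNF of the equation `⨁ v ∈ S, x_v = a`: one clause in the variables `S` for each
assignment to `S` that violates the equation, namely the clause excluding that assignment. -/
def parityCNF {V : Type} [Fintype V] [DecidableEq V] (S : Finset V) (a : ZMod 2) : CNF V :=
  (Finset.univ.filter (fun y : V → ZMod 2 => ∑ v ∈ S, y v ≠ a)).image
    (fun y => S.image (fun v => (v, y v + 1)))

/-- The CNF formula encoding the linear system `M x = b`. -/
def systemCNF {R V : Type} [Fintype R] [Fintype V] [DecidableEq V]
    (M : Matrix R V (ZMod 2)) (b : R → ZMod 2) : CNF V :=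
  Finset.univ.biUnion (fun i => parityCNF (rowSupport M i) (b i))

/-- The formula encoding `A x = b` together with the additional equation `x_i ⊕ x_j = 0`. -/
def extendedCNF {n : ℕ} (A : Matrix (Fin n) (Fin n) (ZMod 2)) (i j : Fin n)
    (b : Fin n → ZMod 2) : CNF (Fin n) :=
  systemCNF
    (Matrix.fromRows A (Matrix.of (fun (_ : Unit) => Pi.single i 1 + Pi.single j 1)))
    (Sum.elim b (fun _ => 0))

/-! ### Boundary expanders -/

/-- The boundary of a set of rows: the columns with a one in exactly one of these rows. -/
def boundary {R V : Type} [Fintype V] (M : Matrix R V (ZMod 2)) (I : Finset R) : Finset V :=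
  Finset.univ.filter (fun j => (I.filter (fun i => M i j = 1)).card = 1)

/-- `(r, s, c)`-boundary expanders. -/
def IsBoundaryExpander {R V : Type} [Fintype V] (M : Matrix R V (ZMod 2))
    (r : ℝ) (s : ℕ) (c : ℝ) : Prop :=
  (∀ i, (rowSupport M i).card ≤ s) ∧
    ∀ I : Finset R, (I.card : ℝ) ≤ r → c * (I.card : ℝ) ≤ ((boundary M I).card : ℝ)

/-- The expansion radius `n / log ^ 14 n`, with logarithms to base `β`. -/
noncomputable def radius (β : ℝ) (n : ℕ) : ℝ := (n : ℝ) / (Real.logb β n) ^ 14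

/-- The `n × n` Boolean matrices with full rank over the two-element field, exactly three ones in
each row, at most `K log n` ones in each column, that are
`(n / log ^ 14 n, 3, 11 / 13)`-boundary expanders; logarithms are to base `β`. -/
structure IsSparseExpander (β K : ℝ) (n : ℕ) (A : Matrix (Fin n) (Fin n) (ZMod 2)) : Prop where
  full_rank : A.rank = n
  row_ones : ∀ i, (rowSupport A i).card = 3
  col_ones : ∀ j, ((Finset.univ.filter (fun i => A i j = 1)).card : ℝ) ≤ K * Real.logb β n
  expander : IsBoundaryExpander A (radius β n) 3 (11 / 13)

/-! ### Bad pairs -/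

/-- The pair `(i, j)` is bad: `i < j`, and for some right-hand side `b` some substitution of a
single variable in the formula of `A x = b`, `x_i ⊕ x_j = 0` gives an unsatisfiable formula that
has a tree-like resolution refutation of size less than `2 ^ (9 r / 130 - 3)`. -/
def IsBadPair {n : ℕ} (A : Matrix (Fin n) (Fin n) (ZMod 2)) (r : ℝ) (i j : Fin n) : Prop :=
  i < j ∧ ∃ (b : Fin n → ZMod 2) (v : Fin n) (a : ZMod 2),
    ¬ CNF.Satisfiable ((extendedCNF A i j b).subst v a) ∧
      ∃ π : Refutation ((extendedCNF A i j b).subst v a),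
        (π.size : ℝ) < (2 : ℝ) ^ (9 * r / 130 - 3)

end XorSys

namespace XorSys

/-! Every bad pair is `Near`: its two variables are linked by a chain of three rows
(`IsBadPair.near`). If `d` bounds the column weights there are at most `81 n d²` such pairs
(`ncard_near_le`), and `d ≤ K log n`.

If `i ≠ j` are not `Near`, expansion shows that no nonempty combination of at most `r` rows of the
extended system is supported on a single variable (`eq_zero_of_coeff_eq_zero`), so few equations
cannot contradict the substituted value. A Prover–Delayer argument then makes tree-like refutations
large (`two_pow_le_refutation_size`): keep a partial assignment that no combination of at most `N`
equations contradicts, and descend the tree through clauses it falsifies. A resolved variable forced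
by such a combination costs nothing; an unforced one may take both values, so both subtrees are
large. No clause of the formula is falsified before `P` values are set: expansion makes the forcing
combinations short, so those for the variables of a clause, added to its equation, stay within `N`
and contradict the assignment. -/

theorem zmod_two_eq_or (c d : ZMod 2) : c = d ∨ c = d + 1 := by
  revert c d; decide

theorem sum_mul_eq_sum_rowSupport {R V : Type} [Fintype V] (M : Matrix R V (ZMod 2)) (i : R) (x : V → ZMod 2) :
    ∑ l, M i l * x l = ∑ l ∈ rowSupport M i, x l := by
  rw [rowSupport, Finset.sum_filter]
  refine Finset.sum_congr rfl fun l _ => ?_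
  rcases zmod_two_eq_or (M i l) 0 with h | h <;> simp [h]

theorem ResTree.one_le_size {V : Type} [DecidableEq V] {F : CNF V} {C : Clause V} (π : ResTree F C) : 1 ≤ π.size := by
  cases π <;> simp [ResTree.size]

/-! ### The Delayer's strategy and the tree-size lower bound. -/

section Delayer

variable {R V : Type} [Fintype R] [Fintype V]

/-- The number of rows that take part in a linear combination. -/
def weight (f : R → ZMod 2) : ℕ := (Finset.univ.filter (fun i => f i ≠ 0)).card

theorem weight_zero : weight (0 : R → ZMod 2) = 0 := by simp [weight]

theorem weight_add_le (f g : R → ZMod 2) : weight (f + g) ≤ weight f + weight g := by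
  classical
  unfold weight
  refine le_trans (Finset.card_le_card ?_) (Finset.card_union_le _ _)
  intro i hi
  simp only [Finset.mem_union, Finset.mem_filter, Finset.mem_univ, true_and, Pi.add_apply] at *
  by_contra! h
  exact hi (by rw [h.1, h.2, add_zero])

theorem weight_single_le [DecidableEq R] (i : R) (a : ZMod 2) :
    weight (Pi.single i a : R → ZMod 2) ≤ 1 := by
  refine (Finset.card_le_card (t := {i}) ?_).trans (Finset.card_singleton i).le
  intro k hk
  by_contra h
  simp only [Finset.mem_singleton] at h
  simp [h] at hk

theorem weight_sum_le {ι : Type} (S : Finset ι) (f : ι → R → ZMod 2) (q : ℕ)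
    (h : ∀ k ∈ S, weight (f k) ≤ q) : weight (∑ k ∈ S, f k) ≤ S.card * q := by
  classical
  induction S using Finset.induction_on with
  | empty => simp [weight_zero]
  | insert k S hk ih =>
    rw [Finset.sum_insert hk, Finset.card_insert_of_notMem hk]
    have h1 := weight_add_le (f k) (∑ l ∈ S, f l)
    have h2 := h k (Finset.mem_insert_self _ _)
    have h3 := ih fun l hl => h l (Finset.mem_insert_of_mem hl)
    linarith

/-- The combination with coefficients `f` of the equations `M x + b = 0`, evaluated at `x`. -/
def combination (M : Matrix R V (ZMod 2)) (b : R → ZMod 2) (f : R → ZMod 2)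
    (x : V → ZMod 2) : ZMod 2 :=
  ∑ i, f i * (∑ l, M i l * x l + b i)

/-- The coefficient of a variable in a combination of rows. -/
def coeff (M : Matrix R V (ZMod 2)) (f : R → ZMod 2) (l : V) : ZMod 2 := ∑ i, f i * M i l

theorem combination_zero (M : Matrix R V (ZMod 2)) (b : R → ZMod 2) (x : V → ZMod 2) :
    combination M b 0 x = 0 := by simp [combination]

theorem combination_add (M : Matrix R V (ZMod 2)) (b f g : R → ZMod 2) (x : V → ZMod 2) :
    combination M b (f + g) x = combination M b f x + combination M b g x := by
  simp [combination, add_mul, Finset.sum_add_distrib]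

theorem combination_sum {ι : Type} (M : Matrix R V (ZMod 2)) (b : R → ZMod 2) (S : Finset ι)
    (f : ι → R → ZMod 2) (x : V → ZMod 2) :
    combination M b (∑ k ∈ S, f k) x = ∑ k ∈ S, combination M b (f k) x := by
  simp only [combination, Finset.sum_apply, Finset.sum_mul]
  exact Finset.sum_comm

theorem combination_single [DecidableEq R] (M : Matrix R V (ZMod 2)) (b : R → ZMod 2) (i : R)
    (x : V → ZMod 2) :
    combination M b (Pi.single i 1) x = ∑ l, M i l * x l + b i := by
  simp [combination, Pi.single_apply]

theorem combination_flip [DecidableEq V] (M : Matrix R V (ZMod 2)) (b f : R → ZMod 2)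
    (x : V → ZMod 2) (l : V) :
    combination M b f (x + Pi.single l 1) = combination M b f x + coeff M f l := by
  unfold combination coeff
  rw [← Finset.sum_add_distrib]
  refine Finset.sum_congr rfl fun i _ => ?_
  have h : ∑ k, M i k * (x + Pi.single l 1 : V → ZMod 2) k = ∑ k, M i k * x k + M i l := by
    simp [mul_add, Finset.sum_add_distrib, Pi.single_apply]
  rw [h]
  ring

/-- Some combination of at most `N` equations forces `x k = a` once the variables in `J` have
the values given by `ρ`. -/
def Implied (M : Matrix R V (ZMod 2)) (b : R → ZMod 2) (N : ℕ) (J : Finset V)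
    (ρ : V → ZMod 2) (k : V) (a : ZMod 2) : Prop :=
  ∃ f : R → ZMod 2, weight f ≤ N ∧
    ∀ x : V → ZMod 2, (∀ l ∈ J, x l = ρ l) → x k + combination M b f x = a

/-- No combination of at most `N` equations contradicts the values of `ρ` on `J`. -/
def Consistent (M : Matrix R V (ZMod 2)) (b : R → ZMod 2) (N : ℕ) (J : Finset V)
    (ρ : V → ZMod 2) : Prop :=
  ∀ f : R → ZMod 2, weight f ≤ N →
    ¬ ∀ x : V → ZMod 2, (∀ l ∈ J, x l = ρ l) → combination M b f x = 1

theorem implied_of_mem (M : Matrix R V (ZMod 2)) (b : R → ZMod 2) (N : ℕ) {J : Finset V}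
    (ρ : V → ZMod 2) {k : V} (hk : k ∈ J) : Implied M b N J ρ k (ρ k) :=
  ⟨0, by simp [weight_zero], fun x hx => by rw [combination_zero, add_zero, hx k hk]⟩

variable [DecidableEq V]

theorem Implied.insert_update {M : Matrix R V (ZMod 2)} {b : R → ZMod 2} {N : ℕ} {J : Finset V}
    {ρ : V → ZMod 2} {l : V} {c : ZMod 2} (h : Implied M b N J ρ l c) {k : V} (hk : k ∉ J)
    (d : ZMod 2) : Implied M b N (insert k J) (Function.update ρ k d) l c := by
  obtain ⟨f, hf, hx⟩ := h
  refine ⟨f, hf, fun x h => hx x fun m hm => ?_⟩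
  rw [h m (Finset.mem_insert_of_mem hm), Function.update_of_ne]
  rintro rfl
  exact hk hm

/-- Flipping a free variable changes an affine function by its coefficient. This confines the
support of a forcing combination, so that expansion can bound its weight. -/
theorem coeff_eq_zero_of_forced {M : Matrix R V (ZMod 2)} {b f : R → ZMod 2} {J : Finset V}
    {ρ : V → ZMod 2} {k : V} {c : ZMod 2}
    (h : ∀ x : V → ZMod 2, (∀ l ∈ J, x l = ρ l) → x k + combination M b f x = c) {l : V}
    (hl : l ∉ insert k J) : coeff M f l = 0 := by
  rw [Finset.mem_insert, not_or] at hl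
  have h1 := h ρ fun _ _ => rfl
  have h2 := h (ρ + Pi.single l 1) fun m hm => by
    have : m ≠ l := by rintro rfl; exact hl.2 hm
    simp [this]
  rw [combination_flip] at h2
  simp only [Pi.add_apply, Pi.single_apply, Ne.symm hl.1, if_false, add_zero] at h2
  rw [← h1, ← add_assoc] at h2
  simpa using h2

theorem coeff_eq_zero_of_const {M : Matrix R V (ZMod 2)} {b f : R → ZMod 2} {J : Finset V}
    {ρ : V → ZMod 2} {c : ZMod 2}
    (h : ∀ x : V → ZMod 2, (∀ l ∈ J, x l = ρ l) → combination M b f x = c) {l : V}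
    (hl : l ∉ J) : coeff M f l = 0 := by
  have h1 := h ρ fun _ _ => rfl
  have h2 := h (ρ + Pi.single l 1) fun m hm => by
    have : m ≠ l := by rintro rfl; exact hl hm
    simp [this]
  rw [combination_flip, h1] at h2
  simpa using h2

/-- An undetermined variable can be given any value. -/
theorem Consistent.insert_update {M : Matrix R V (ZMod 2)} {b : R → ZMod 2} {N : ℕ}
    {J : Finset V} {ρ : V → ZMod 2} (h : Consistent M b N J ρ) {k : V}
    (hk : ∀ c, ¬ Implied M b N J ρ k c) (d : ZMod 2) :
    Consistent M b N (insert k J) (Function.update ρ k d) := by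
  have hkJ : k ∉ J := fun hk' => hk _ (implied_of_mem M b N ρ hk')
  intro f hf hx
  have key : ∀ x : V → ZMod 2, (∀ l ∈ J, x l = ρ l) → x k = d → combination M b f x = 1 := by
    intro x hxJ hxk
    refine hx x fun l hl => ?_
    by_cases hlk : l = k
    · subst hlk
      rw [hxk, Function.update_self]
    · rw [Function.update_of_ne hlk]
      exact hxJ l ((Finset.mem_insert.1 hl).resolve_left hlk)
  have key2 : ∀ x : V → ZMod 2, (∀ l ∈ J, x l = ρ l) → x k = d + 1 →
      combination M b f x + coeff M f k = 1 := by
    intro x hxJ hxk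
    rw [← combination_flip]
    refine key _ (fun l hl => ?_) ?_
    · have : l ≠ k := by rintro rfl; exact hkJ hl
      simp [this, hxJ l hl]
    · simp only [Pi.add_apply, Pi.single_eq_same, hxk, add_assoc, CharTwo.add_self_eq_zero,
        add_zero]
  -- If `k` does not occur in the combination, it already contradicted `ρ`; if it occurs, the
  -- combination forces `x k = d + 1`, contrary to `hk`.
  rcases zmod_two_eq_or (coeff M f k) 0 with h0 | h1
  · refine h f hf fun x hxJ => ?_
    rcases zmod_two_eq_or (x k) d with hd | hd
    · exact key x hxJ hd
    · simpa [h0] using key2 x hxJ hd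
  · refine hk (d + 1) ⟨f, hf, fun x hxJ => ?_⟩
    rcases zmod_two_eq_or (x k) d with hd | hd
    · rw [hd, key x hxJ hd]
    · have := key2 x hxJ hd
      rw [h1, zero_add, add_eq_right] at this
      rw [hd, this, add_zero]

/-- A consistent state falsifies no clause of the formula. -/
theorem Consistent.not_falsified {M : Matrix R V (ZMod 2)} {b : R → ZMod 2} {N q : ℕ}
    {J : Finset V} {ρ : V → ZMod 2} (h : Consistent M b N J ρ)
    (hrow : ∀ i, (rowSupport M i).card ≤ 3) (hN : 1 + 3 * q ≤ N)
    (hq : ∀ (f : R → ZMod 2) (k : V), weight f ≤ N →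
      (∀ l ∉ insert k J, coeff M f l = 0) → weight f ≤ q)
    {C : Clause V} (hC : C ∈ systemCNF M b) :
    ¬ ∀ l ∈ C, Implied M b N J ρ l.1 (l.2 + 1) := by
  classical
  intro hl
  simp only [systemCNF, parityCNF, Finset.mem_biUnion, Finset.mem_image, Finset.mem_filter,
    Finset.mem_univ, true_and] at hC
  obtain ⟨i, y, hy, rfl⟩ := hC
  have him : ∀ k ∈ rowSupport M i, Implied M b N J ρ k (y k) := by
    intro k hk
    have := hl (k, y k + 1) (Finset.mem_image_of_mem _ hk)
    simpa only [add_assoc, CharTwo.add_self_eq_zero, add_zero] using this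
  choose! f hf hfx using him
  have hfq : ∀ k ∈ rowSupport M i, weight (f k) ≤ q := fun k hk =>
    hq (f k) k (hf k hk) fun l hl => coeff_eq_zero_of_forced (hfx k hk) hl
  -- The violated equation plus the forcing combinations of its variables is identically `1`; its
  -- weight is at most `1 + 3 * q`.
  refine h (Pi.single i 1 + ∑ k ∈ rowSupport M i, f k) ?_ fun x hx => ?_
  · have h1 := weight_add_le (Pi.single i 1) (∑ k ∈ rowSupport M i, f k)
    have h2 := weight_single_le i (1 : ZMod 2)
    have h3 := weight_sum_le _ f q hfq
    have h4 := Nat.mul_le_mul_right q (hrow i)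
    omega
  · rw [combination_add, combination_single, combination_sum, sum_mul_eq_sum_rowSupport]
    have h1 : ∑ k ∈ rowSupport M i, x k + ∑ k ∈ rowSupport M i, combination M b (f k) x
        = ∑ k ∈ rowSupport M i, y k := by
      rw [← Finset.sum_add_distrib]
      exact Finset.sum_congr rfl fun k hk => hfx k hk x hx
    rw [add_right_comm, h1]
    rcases zmod_two_eq_or (∑ k ∈ rowSupport M i, y k) (b i) with h2 | h2
    · exact absurd h2 hy
    · rw [h2, add_right_comm, CharTwo.add_self_eq_zero, zero_add]

/-- A derivation of a clause that is falsified in a consistent state is large. -/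
theorem ResTree.two_pow_le_size {M : Matrix R V (ZMod 2)} {b : R → ZMod 2} {N q P : ℕ}
    {v : V} {a : ZMod 2} (hrow : ∀ i, (rowSupport M i).card ≤ 3) (hN : 1 + 3 * q ≤ N)
    (hq : ∀ (f : R → ZMod 2) (J : Finset V), J.card ≤ P → weight f ≤ N →
      (∀ l ∉ J, coeff M f l = 0) → weight f ≤ q)
    {C : Clause V} (π : ResTree ((systemCNF M b).subst v a) C) :
    ∀ (J : Finset V) (ρ : V → ZMod 2), v ∈ J → ρ v = a → Consistent M b N J ρ →
      (∀ l ∈ C, Implied M b N J ρ l.1 (l.2 + 1)) → 2 ^ P ≤ π.size * 2 ^ J.card := by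
  induction π with
  | leaf C hC =>
    intro J ρ hv hρ hcons hfal
    -- The forced variable joins `J` in the support of its combination, so the weight bound needs
    -- `J.card < P` strictly.
    rcases lt_or_ge J.card P with hJ | hJ
    · exfalso
      simp only [CNF.subst, Finset.mem_image, Finset.mem_filter] at hC
      obtain ⟨D, ⟨hD, -⟩, rfl⟩ := hC
      refine hcons.not_falsified hrow hN (fun f k hf hl =>
        hq f (insert k J) ((Finset.card_insert_le _ _).trans hJ) hf hl) hD fun l hl => ?_
      by_cases hlv : l = (v, a + 1)
      · subst hlv
        have := implied_of_mem M b N ρ hv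
        simpa only [add_assoc, CharTwo.add_self_eq_zero, add_zero, hρ] using this
      · exact hfal l (Finset.mem_erase.2 ⟨hlv, hl⟩)
    · simpa [ResTree.size] using Nat.pow_le_pow_right (by norm_num : 0 < 2) hJ
  | resolve k C D hC hD s t ihs iht =>
    intro J ρ hv hρ hcons hfal
    have hsz : (ResTree.resolve k C D hC hD s t).size = s.size + t.size + 1 := rfl
    rw [hsz]
    have hCf : ∀ l ∈ C, l ≠ (k, 1) → Implied M b N J ρ l.1 (l.2 + 1) := fun l hl hne =>
      hfal l (Finset.mem_union_left _ (Finset.mem_erase.2 ⟨hne, hl⟩))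
    have hDf : ∀ l ∈ D, l ≠ (k, 0) → Implied M b N J ρ l.1 (l.2 + 1) := fun l hl hne =>
      hfal l (Finset.mem_union_right _ (Finset.mem_erase.2 ⟨hne, hl⟩))
    by_cases h0 : Implied M b N J ρ k 0
    · refine (ihs J ρ hv hρ hcons fun l hl => ?_).trans (Nat.mul_le_mul_right _ (by omega))
      by_cases hne : l = (k, 1)
      · subst hne
        simpa only [CharTwo.add_self_eq_zero] using h0
      · exact hCf l hl hne
    by_cases h1 : Implied M b N J ρ k 1
    · refine (iht J ρ hv hρ hcons fun l hl => ?_).trans (Nat.mul_le_mul_right _ (by omega))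
      by_cases hne : l = (k, 0)
      · subst hne
        simpa only [zero_add] using h1
      · exact hDf l hl hne
    have hfree : ∀ c, ¬ Implied M b N J ρ k c := by
      intro c
      rcases zmod_two_eq_or c 0 with rfl | rfl
      · exact h0
      · exact h1
    have hkJ : k ∉ J := fun hk' => hfree _ (implied_of_mem M b N ρ hk')
    have hvk : v ≠ k := by rintro rfl; exact hkJ hv
    have hs := ihs (insert k J) (Function.update ρ k 0) (Finset.mem_insert_of_mem hv)
      (by rw [Function.update_of_ne hvk, hρ]) (hcons.insert_update hfree 0) fun l hl => by
        by_cases hne : l = (k, 1)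
        · subst hne
          have := implied_of_mem M b N (Function.update ρ k 0) (Finset.mem_insert_self k J)
          simpa only [CharTwo.add_self_eq_zero, Function.update_self] using this
        · exact (hCf l hl hne).insert_update hkJ 0
    have ht := iht (insert k J) (Function.update ρ k 1) (Finset.mem_insert_of_mem hv)
      (by rw [Function.update_of_ne hvk, hρ]) (hcons.insert_update hfree 1) fun l hl => by
        by_cases hne : l = (k, 0)
        · subst hne
          have := implied_of_mem M b N (Function.update ρ k 1) (Finset.mem_insert_self k J)
          simpa only [zero_add, Function.update_self] using this
        · exact (hDf l hl hne).insert_update hkJ 1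
    -- Each subtree loses a factor two to the larger `J`; the sum of the two sizes regains it.
    rw [Finset.card_insert_of_notMem hkJ, pow_succ] at hs ht
    nlinarith [Nat.zero_le (2 ^ J.card)]

/-- A tree-like size lower bound for linear systems without small dependencies. -/
theorem two_pow_le_refutation_size {M : Matrix R V (ZMod 2)} {b : R → ZMod 2} {N q P : ℕ}
    {v : V} {a : ZMod 2} (hrow : ∀ i, (rowSupport M i).card ≤ 3) (hN : 1 + 3 * q ≤ N)
    (hq : ∀ (f : R → ZMod 2) (J : Finset V), J.card ≤ P → weight f ≤ N →
      (∀ l ∉ J, coeff M f l = 0) → weight f ≤ q)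
    (hind : ∀ f : R → ZMod 2, weight f ≤ N → (∀ l, l ≠ v → coeff M f l = 0) → f = 0)
    (π : Refutation ((systemCNF M b).subst v a)) : 2 ^ P ≤ π.size * 2 := by
  -- The substituted variable is already set in the initial state, whence the factor `2`.
  have h := π.two_pow_le_size hrow hN hq {v} (fun _ => a) (Finset.mem_singleton_self v) rfl
    (fun f hf hx => by
      have hf0 : f = 0 := hind f hf fun l hl =>
        coeff_eq_zero_of_const hx (by simpa using hl)
      have := hx (fun _ => a) fun _ _ => rfl
      rw [hf0, combination_zero] at this
      exact zero_ne_one this)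
    (fun l hl => absurd hl (Finset.notMem_empty l))
  simpa using h

end Delayer

/-! ### Counting pairs joined by a chain of three rows. -/

section Pairs

variable {n : ℕ}

/-- The variables `i` and `j` are joined by a chain of three rows. -/
def Near (A : Matrix (Fin n) (Fin n) (ZMod 2)) (i j : Fin n) : Prop :=
  ∃ s t u k l, i ∈ rowSupport A s ∧ k ∈ rowSupport A s ∧ k ∈ rowSupport A t ∧
    l ∈ rowSupport A t ∧ l ∈ rowSupport A u ∧ j ∈ rowSupport A u

/-- Choose the middle row, its columns `k` and `l`, the outer rows through them, and finally `i` and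
`j`: the factors are `n`, `9`, `d * d` and `9`. -/
theorem ncard_near_le (A : Matrix (Fin n) (Fin n) (ZMod 2)) (d : ℕ)
    (hrow : ∀ i, (rowSupport A i).card = 3)
    (hcol : ∀ j, (Finset.univ.filter (fun i => A i j = 1)).card ≤ d) :
    {p : Fin n × Fin n | Near A p.1 p.2}.ncard ≤ n * (9 * (d * d * 9)) := by
  classical
  let T : Finset (Fin n × Fin n) := Finset.univ.biUnion fun t : Fin n =>
    (rowSupport A t ×ˢ rowSupport A t).biUnion fun m =>
      ((Finset.univ.filter (fun i => A i m.1 = 1)) ×ˢ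
        (Finset.univ.filter (fun i => A i m.2 = 1))).biUnion fun c =>
          rowSupport A c.1 ×ˢ rowSupport A c.2
  have hsub : {p : Fin n × Fin n | Near A p.1 p.2} ⊆ (T : Set (Fin n × Fin n)) := by
    rintro ⟨i, j⟩ ⟨s, t, u, k, l, h1, h2, h3, h4, h5, h6⟩
    refine Finset.mem_coe.2 (Finset.mem_biUnion.2 ⟨t, Finset.mem_univ t, Finset.mem_biUnion.2
      ⟨(k, l), Finset.mem_product.2 ⟨h3, h4⟩, Finset.mem_biUnion.2 ⟨(s, u), ?_,
        Finset.mem_product.2 ⟨h1, h6⟩⟩⟩⟩)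
    simp only [rowSupport, Finset.mem_filter, Finset.mem_univ, true_and] at h2 h5
    simp [h2, h5]
  refine (Set.ncard_le_ncard hsub (Finset.finite_toSet T)).trans ?_
  rw [Set.ncard_coe_finset]
  refine (Finset.card_biUnion_le_card_mul _ _ (9 * (d * d * 9)) fun t _ => ?_).trans
    (by rw [Finset.card_univ, Fintype.card_fin])
  refine (Finset.card_biUnion_le_card_mul _ _ (d * d * 9) fun m _ => ?_).trans
    (by rw [Finset.card_product, hrow])
  refine (Finset.card_biUnion_le_card_mul _ _ 9 fun c _ => ?_).trans ?_
  · rw [Finset.card_product, hrow, hrow]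
  · rw [Finset.card_product]
    exact Nat.mul_le_mul_right _ (Nat.mul_le_mul (hcol _) (hcol _))

/-! ### Expansion and small dependencies of the extended system. -/

/-- The rows of `A` that take part in a combination of rows of the extended system. -/
def oldRows (f : Fin n ⊕ Unit → ZMod 2) : Finset (Fin n) :=
  Finset.univ.filter (fun i => f (Sum.inl i) ≠ 0)

/-- The matrix `A` with the additional row `e_i + e_j`. -/
abbrev extendedMatrix (A : Matrix (Fin n) (Fin n) (ZMod 2)) (i j : Fin n) :
    Matrix (Fin n ⊕ Unit) (Fin n) (ZMod 2) :=
  Matrix.fromRows A (Matrix.of (fun (_ : Unit) => Pi.single i 1 + Pi.single j 1))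

theorem weight_eq_oldRows (f : Fin n ⊕ Unit → ZMod 2) :
    weight f = (oldRows f).card + if f (Sum.inr ()) ≠ 0 then 1 else 0 := by
  simp only [weight, oldRows, Finset.card_filter, Fintype.sum_sum_type]
  simp

theorem coeff_extendedMatrix (A : Matrix (Fin n) (Fin n) (ZMod 2)) (i j : Fin n)
    (f : Fin n ⊕ Unit → ZMod 2) (l : Fin n) :
    coeff (extendedMatrix A i j) f l = ∑ k ∈ oldRows f, A k l +
      f (Sum.inr ()) * ((Pi.single i 1 + Pi.single j 1 : Fin n → ZMod 2) l) := by
  simp only [coeff, Fintype.sum_sum_type, oldRows, Finset.sum_filter]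
  congr 1
  · refine Finset.sum_congr rfl fun k _ => ?_
    rcases zmod_two_eq_or (f (Sum.inl k)) 0 with h | h <;> simp [h]
  · simp

theorem sum_eq_card_filter (A : Matrix (Fin n) (Fin n) (ZMod 2)) (I : Finset (Fin n))
    (l : Fin n) : ∑ k ∈ I, A k l = ((I.filter (fun k => A k l = 1)).card : ZMod 2) := by
  rw [Finset.card_filter, Nat.cast_sum]
  refine Finset.sum_congr rfl fun k _ => ?_
  rcases zmod_two_eq_or (A k l) 0 with h | h <;> simp [h]

theorem boundary_subset (A : Matrix (Fin n) (Fin n) (ZMod 2)) (I S : Finset (Fin n))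
    (h : ∀ l ∉ S, ∑ k ∈ I, A k l = 0) : boundary A I ⊆ S := by
  intro l hl
  by_contra hS
  have := h l hS
  rw [sum_eq_card_filter, (Finset.mem_filter.1 hl).2] at this
  simp at this

variable {A : Matrix (Fin n) (Fin n) (ZMod 2)} {r : ℝ}

/-- A column met by exactly one row of `I` has sum one, so the boundary lies in `S`. -/
theorem card_le_of_sum_eq_zero (hA : IsBoundaryExpander A r 3 (11 / 13)) {I S : Finset (Fin n)}
    (hI : (I.card : ℝ) ≤ r) (h : ∀ l ∉ S, ∑ k ∈ I, A k l = 0) : 11 * I.card ≤ 13 * S.card := by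
  have h1 := hA.2 I hI
  have h2 : ((boundary A I).card : ℝ) ≤ S.card :=
    Nat.cast_le.2 (Finset.card_le_card (boundary_subset A I S h))
  have h3 : (11 * I.card : ℝ) ≤ 13 * S.card := by linarith
  exact_mod_cast h3

/-- The additional row accounts for the summand `11` and, through its columns `i` and `j`, for the
`+ 2`. -/
theorem weight_le_of_coeff_eq_zero (hA : IsBoundaryExpander A r 3 (11 / 13)) (i j : Fin n)
    {f : Fin n ⊕ Unit → ZMod 2} (hf : (weight f : ℝ) ≤ r) {J : Finset (Fin n)}
    (h : ∀ l ∉ J, coeff (extendedMatrix A i j) f l = 0) :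
    11 * weight f ≤ 11 + 13 * (J.card + 2) := by
  have hw := weight_eq_oldRows f
  have hI : ((oldRows f).card : ℝ) ≤ r := le_trans (Nat.cast_le.2 (by omega)) hf
  have h1 := card_le_of_sum_eq_zero hA hI (S := J ∪ {i, j}) fun l hl => by
    simp only [Finset.mem_union, Finset.mem_insert, Finset.mem_singleton, not_or] at hl
    have := h l hl.1
    rw [coeff_extendedMatrix] at this
    simpa [hl.2.1, hl.2.2, Pi.single_apply] using this
  have h2 := Finset.card_union_le J {i, j}
  have h3 := Finset.card_le_two (a := i) (b := j)
  split_ifs at hw <;> omega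

theorem sum_eq_zero_of_forall_notMem {I : Finset (Fin n)} {l : Fin n}
    (h : ∀ s ∈ I, l ∉ rowSupport A s) : ∑ k ∈ I, A k l = 0 := by
  refine Finset.sum_eq_zero fun k hk => ?_
  have := h k hk
  simp only [rowSupport, Finset.mem_filter, Finset.mem_univ, true_and] at this
  exact (zmod_two_eq_or (A k l) 0).resolve_right (by simpa using this)

/-- A row disjoint from the other rows of a sum is contained in the support of the sum. -/
theorem rowSupport_subset_of_disjoint {I S : Finset (Fin n)} {s : Fin n} (hs : s ∈ I)
    (hd : ∀ t ∈ I, t ≠ s → Disjoint (rowSupport A s) (rowSupport A t))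
    (h : ∀ l ∉ S, ∑ k ∈ I, A k l = 0) : rowSupport A s ⊆ S := by
  intro l hl
  by_contra hS
  have h1 := h l hS
  rw [← Finset.add_sum_erase I _ hs, sum_eq_zero_of_forall_notMem fun t ht =>
    Finset.disjoint_left.1 (hd t (Finset.mem_of_mem_erase ht) (Finset.ne_of_mem_erase ht)) hl]
    at h1
  simp only [rowSupport, Finset.mem_filter, Finset.mem_univ, true_and] at hl
  simp [hl] at h1

/-- If a sum of at most three rows contains `i` and `j` and at most one other variable, then these
rows contain a chain from `i` to `j`. -/
theorem near_of_sum {i j v : Fin n} (hrow : ∀ s, (rowSupport A s).card = 3)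
    {I : Finset (Fin n)} (hI : I.card ≤ 3) (hi : ∑ k ∈ I, A k i ≠ 0) (hj : ∑ k ∈ I, A k j ≠ 0)
    (h : ∀ l ∉ ({i, j, v} : Finset (Fin n)), ∑ k ∈ I, A k l = 0) : Near A i j := by
  have hs : ∃ s ∈ I, i ∈ rowSupport A s := by
    by_contra! hc; exact hi (sum_eq_zero_of_forall_notMem hc)
  have hu : ∃ u ∈ I, j ∈ rowSupport A u := by
    by_contra! hc; exact hj (sum_eq_zero_of_forall_notMem hc)
  obtain ⟨s, hsI, his⟩ := hs
  obtain ⟨u, huI, hju⟩ := hu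
  have hsub : ∀ t ∈ I, (∀ m ∈ I, m ≠ t → Disjoint (rowSupport A t) (rowSupport A m)) →
      i ∈ rowSupport A t ∧ j ∈ rowSupport A t := by
    intro t ht hd
    have hsub := rowSupport_subset_of_disjoint ht hd h
    have : rowSupport A t = {i, j, v} :=
      Finset.eq_of_subset_of_card_le hsub (by rw [hrow]; exact Finset.card_le_three)
    simp [this]
  by_contra hnear
  have hsame : ∀ t, i ∈ rowSupport A t → j ∉ rowSupport A t := fun t h1 h2 =>
    hnear ⟨t, t, t, i, j, h1, h1, h1, h2, h2, h2⟩
  have hsu : s ≠ u := by rintro rfl; exact hsame s his hju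
  have hdsu : Disjoint (rowSupport A s) (rowSupport A u) :=
    Finset.disjoint_left.2 fun k h1 h2 => hnear ⟨s, s, u, i, k, his, his, his, h1, h2, hju⟩
  -- A row of `I` disjoint from all others would be `{i, j, v}` and contain both ends, so `s` and
  -- `u` each meet another row; with only three rows available it is the same one.
  have hex1 : ∃ t ∈ I, t ≠ s ∧ ¬ Disjoint (rowSupport A s) (rowSupport A t) := by
    by_contra! hc
    have := hsub s hsI hc
    exact hsame s this.1 this.2
  have hex2 : ∃ t ∈ I, t ≠ u ∧ ¬ Disjoint (rowSupport A u) (rowSupport A t) := by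
    by_contra! hc
    have := hsub u huI hc
    exact hsame u this.1 this.2
  obtain ⟨t, htI, hts, htd⟩ := hex1
  obtain ⟨m, hmI, hmu, hmd⟩ := hex2
  have htu : t ≠ u := by rintro rfl; exact htd hdsu
  have hms : m ≠ s := by rintro rfl; exact hmd hdsu.symm
  have htm : t = m := by
    by_contra htm
    have h4 : ({s, u, t, m} : Finset (Fin n)).card = 4 := by
      rw [Finset.card_insert_of_notMem (by simp [hsu, hts.symm, hms.symm]),
        Finset.card_insert_of_notMem (by simp [htu.symm, hmu.symm]), Finset.card_pair htm]
    have : ({s, u, t, m} : Finset (Fin n)) ⊆ I := by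
      simp only [Finset.insert_subset_iff, Finset.singleton_subset_iff]
      exact ⟨hsI, huI, htI, hmI⟩
    have := Finset.card_le_card this
    omega
  subst htm
  obtain ⟨k, hk1, hk2⟩ := Finset.not_disjoint_iff.1 htd
  obtain ⟨l, hl1, hl2⟩ := Finset.not_disjoint_iff.1 hmd
  exact hnear ⟨s, t, u, k, l, his, hk1, hk2, hl2, hl1, hju⟩

/-- Expansion gives `11 * I.card ≤ 13`, so at most one row is left, and a single row has three ones.
-/
theorem eq_empty_of_sum_eq_zero (hA : IsBoundaryExpander A r 3 (11 / 13))
    (hrow : ∀ s, (rowSupport A s).card = 3) {I : Finset (Fin n)} (hI : (I.card : ℝ) ≤ r)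
    {v : Fin n} (h : ∀ l, l ≠ v → ∑ k ∈ I, A k l = 0) : I = ∅ := by
  have h1 := card_le_of_sum_eq_zero hA hI (S := {v}) fun l hl => h l (by simpa using hl)
  rw [Finset.card_singleton] at h1
  by_contra hne
  have hcard : I.card = 1 := by
    have := Finset.card_pos.2 (Finset.nonempty_iff_ne_empty.2 hne)
    omega
  obtain ⟨s, rfl⟩ := Finset.card_eq_one.1 hcard
  have hsub : rowSupport A s ⊆ {v} := rowSupport_subset_of_disjoint (Finset.mem_singleton_self s)
    (fun t ht hts => absurd (Finset.mem_singleton.1 ht) hts) fun l hl => h l (by simpa using hl)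
  have := Finset.card_le_card hsub
  rw [hrow, Finset.card_singleton] at this
  omega

/-- Without the additional row this is `eq_empty_of_sum_eq_zero`. With it, the rows of `A` sum to
`e_i + e_j` away from `v`; expansion leaves at most `⌊39 / 11⌋ = 3` of them, and these would contain
a chain. -/
theorem eq_zero_of_coeff_eq_zero (hA : IsBoundaryExpander A r 3 (11 / 13))
    (hrow : ∀ s, (rowSupport A s).card = 3) {i j : Fin n} (hij : i ≠ j) (hnear : ¬ Near A i j)
    {v : Fin n} {f : Fin n ⊕ Unit → ZMod 2} (hf : (weight f : ℝ) ≤ r)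
    (h : ∀ l, l ≠ v → coeff (extendedMatrix A i j) f l = 0) : f = 0 := by
  have hw := weight_eq_oldRows f
  have hI : ((oldRows f).card : ℝ) ≤ r := le_trans (Nat.cast_le.2 (by omega)) hf
  simp only [coeff_extendedMatrix] at h
  rcases zmod_two_eq_or (f (Sum.inr ())) 0 with h0 | h1
  · simp only [h0, zero_mul, add_zero] at h
    have hempty := eq_empty_of_sum_eq_zero hA hrow hI h
    funext k
    rcases k with k | ⟨⟩
    · by_contra hk
      have : k ∈ oldRows f := by simpa [oldRows] using hk
      simp [hempty] at this
    · exact h0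
  · exfalso
    rw [zero_add] at h1
    simp only [h1, one_mul, Pi.add_apply] at h
    have hout : ∀ l ∉ ({i, j, v} : Finset (Fin n)), ∑ k ∈ oldRows f, A k l = 0 := by
      intro l hl
      simp only [Finset.mem_insert, Finset.mem_singleton, not_or] at hl
      simpa [hl.1, hl.2.1, Pi.single_apply] using h l hl.2.2
    -- If the sum vanished at one of `i`, `j`, that index would be `v` and the sum would live on the
    -- other alone. Then no row of `A` takes part, and the one of the additional row at the other
    -- index is not cancelled.
    have hin : ∀ l, l = i ∨ l = j → ∑ k ∈ oldRows f, A k l ≠ 0 := by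
      intro l hl hz
      have hlv : l = v := by
        by_contra hlv
        have := h l hlv
        rcases hl with rfl | rfl <;> simp [hz, hij, hij.symm] at this
      have hlast : ∃ m, m ≠ v ∧ (m = i ∨ m = j) ∧
          ∀ p, p ≠ m → ∑ k ∈ oldRows f, A k p = 0 := by
        rcases hl with rfl | rfl
        · refine ⟨j, hlv ▸ hij.symm, Or.inr rfl, fun p hp => ?_⟩
          by_cases hpl : p = l
          · rw [hpl, hz]
          · exact hout p (by simp [hp, hpl, ← hlv])
        · refine ⟨i, hlv ▸ hij, Or.inl rfl, fun p hp => ?_⟩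
          by_cases hpl : p = l
          · rw [hpl, hz]
          · exact hout p (by simp [hp, hpl, ← hlv])
      obtain ⟨m, hmv, hm, hp⟩ := hlast
      have hempty := eq_empty_of_sum_eq_zero hA hrow hI hp
      have := h m hmv
      rcases hm with rfl | rfl <;> simp [hempty, hij, hij.symm] at this
    have hcard := card_le_of_sum_eq_zero hA hI hout
    have := Finset.card_le_three (a := i) (b := j) (c := v)
    exact hnear (near_of_sum hrow (by omega) (hin i (Or.inl rfl)) (hin j (Or.inr rfl)) hout)

theorem card_rowSupport_extendedMatrix_le (hrow : ∀ s, (rowSupport A s).card = 3) (i j : Fin n)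
    (s : Fin n ⊕ Unit) : (rowSupport (extendedMatrix A i j) s).card ≤ 3 := by
  rcases s with s | ⟨⟩
  · exact (hrow s).le
  · refine (Finset.card_le_card (t := {i, j}) ?_).trans (Finset.card_le_two.trans (by norm_num))
    intro l hl
    by_contra hc
    simp only [Finset.mem_insert, Finset.mem_singleton, not_or] at hc
    simp [rowSupport, hc.1, hc.2, Pi.single_apply] at hl

theorem IsBadPair.near (hA : IsBoundaryExpander A r 3 (11 / 13))
    (hrow : ∀ s, (rowSupport A s).card = 3) {i j : Fin n} (hbad : IsBadPair A r i j) :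
    Near A i j := by
  by_contra hnear
  obtain ⟨hij, b, v, a, -, π, hπ⟩ := hbad
  -- Otherwise the size bound is at most `1`, while a tree has a node. The bound on `r` also absorbs
  -- the additive constants in `hN`.
  have hr : 130 / 3 < r := by
    have h1 : (1 : ℝ) ≤ π.size := by exact_mod_cast π.one_le_size
    by_contra! hr
    have h2 : (2 : ℝ) ^ (9 * r / 130 - 3) ≤ 1 :=
      Real.rpow_le_one_of_one_le_of_nonpos (by norm_num) (by linarith)
    linarith
  obtain ⟨P, hP1, hP2⟩ : ∃ P : ℕ, 9 * r / 130 ≤ P ∧ (P : ℝ) < 9 * r / 130 + 1 :=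
    ⟨⌈9 * r / 130⌉₊, Nat.le_ceil _, Nat.ceil_lt_add_one (by linarith)⟩
  -- The largest weight that `weight_le_of_coeff_eq_zero` allows for support in `P` columns. Up to
  -- constants, `1 + 3 * q` is at most `27 * r / 110`, which leaves room below `r`.
  obtain ⟨q, hq⟩ : ∃ q : ℕ, q = (11 + 13 * (P + 2)) / 11 := ⟨_, rfl⟩
  have hN : ((1 + 3 * q : ℕ) : ℝ) ≤ r := by
    have h1 : 11 * q ≤ 11 + 13 * (P + 2) := by omega
    have h2 : (11 * q : ℝ) ≤ 11 + 13 * (P + 2) := by exact_mod_cast h1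
    push_cast
    linarith
  have hlow : 2 ^ P ≤ π.size * 2 :=
    two_pow_le_refutation_size (M := extendedMatrix A i j) (b := Sum.elim b fun _ => 0)
      (card_rowSupport_extendedMatrix_le hrow i j) le_rfl
      (fun f J hJ hf hl => by
        have := weight_le_of_coeff_eq_zero hA i j ((Nat.cast_le.2 hf).trans hN) hl
        omega)
      (fun f hf hl => eq_zero_of_coeff_eq_zero hA hrow hij.ne hnear
        ((Nat.cast_le.2 hf).trans hN) hl) π
  have h1 : (2 : ℝ) ^ P ≤ π.size * 2 := by exact_mod_cast hlow
  have h2 : (2 : ℝ) ^ (9 * r / 130 - 3) ≤ (2 : ℝ) ^ ((P : ℝ) - 1) :=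
    Real.rpow_le_rpow_of_exponent_le (by norm_num) (by linarith)
  rw [Real.rpow_sub_one (by norm_num), Real.rpow_natCast] at h2
  linarith

end Pairs

end XorSys

theorem mainTheorem6 (β : ℝ) (hβ : 1 < β) (K : ℝ) :
    ∃ C : ℝ, ∀ (n : ℕ) (A : Matrix (Fin n) (Fin n) (ZMod 2)),
      XorSys.IsSparseExpander β K n A →
        (({p : Fin n × Fin n | XorSys.IsBadPair A (XorSys.radius β n) p.1 p.2}.ncard : ℕ) : ℝ)
          ≤ C * ((n : ℝ) * (Real.logb β n) ^ 2) := by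
  refine ⟨81 * K ^ 2, fun n A hA => ?_⟩
  rcases Nat.eq_zero_or_pos n with rfl | hn
  · simp [Set.eq_empty_of_isEmpty]
  have hpos : 0 ≤ K * Real.logb β n := (Nat.cast_nonneg _).trans (hA.col_ones ⟨0, hn⟩)
  have h1 := XorSys.ncard_near_le A ⌊K * Real.logb β n⌋₊ hA.row_ones
    fun j => Nat.le_floor (hA.col_ones j)
  have h2 : {p : Fin n × Fin n | XorSys.IsBadPair A (XorSys.radius β n) p.1 p.2}.ncard ≤
      {p : Fin n × Fin n | XorSys.Near A p.1 p.2}.ncard :=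
    Set.ncard_le_ncard (fun p hp => XorSys.IsBadPair.near hA.expander hA.row_ones hp)
      (Set.toFinite _)
  have h3 : ((⌊K * Real.logb β n⌋₊ : ℕ) : ℝ) ≤ K * Real.logb β n := Nat.floor_le hpos
  have h4 := mul_le_mul h3 h3 (Nat.cast_nonneg _) hpos
  have h5 := mul_le_mul_of_nonneg_left h4 (Nat.cast_nonneg (α := ℝ) n)
  have h6 := Nat.cast_le (α := ℝ).2 (h2.trans h1)
  push_cast at h6
  linarith
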